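/- **Objects.** For integers $1\le k\le n$ let $\mathcal{DU}_{n,k}$ be the set of permutations $\sigma=\sigma_1\sigma_2\cdots\sigma_n$ of $[n]=\{1,\dots,n\}$ with $\sigma_1>\sigma_2<\sigma_3>\sigma_4<\cdots$ and $\sigma_1=k$. An increasing 1-2 tree on a finite set $V\subset\mathbb N$ is a rooted tree with vertex set $V$ in which every vertex has at most two children and labels increase along every path away from the root. An only child is called a left child; of two siblings the smaller is the left and the larger the right child. The minimal path starts at the root and follows left children to a leaf, called the minimal leaf. Let $\mathcal T_{n,k}$ be the set of increasing 1-2 trees on $[n]$ with minimal leaf $k$. **Algorithm B (the map $\psi$).** For $n=1,2$, $\psi(\pi)$ is the unique increasing 1-2 tree on $[n]$. Let $n\ge 3$ and $\pi\in\mathcal{DU}_{n,k}$. * (B1) If $\pi_2=k-1$, delete $\pi_1=k$ and $\pi_2=k-1$ from $\pi$ and relabel the remaining word by $[n-2]$, preserving the order, to get $\pi'$. Relabel $\psi(\pi')$ by $[n]\setminus\{k-1,k\}$, preserving the order, to get $T''$. Let $m$ be the smallest vertex greater than $k$ in the minimal path of $T''$. Insert a vertex $k-1$ in the middle of the edge from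 the parent of $m$ to $m$ (if $m$ is the root, $k-1$ becomes the new root with child $m$), and graft $k$ as the left child of $k-1$. The result is $\psi(\pi)$. * (B2) If $\pi_2<k-1$, let $\pi'\in\mathcal{DU}_{n,k-1}$ be obtained by exchanging the letters $k-1$ and $k$ in $\pi$, and let $T'=\psi(\pi')$. (a) If $k-1$ and $k$ are not siblings in $T'$, then $\psi(\pi)$ is $T'$ with the labels $k-1$ and $k$ exchanged. (b) If $k-1$ and $k$ are siblings in $T'$, with parent $\ell$, let $A$ and $B$ be the (possibly empty) left and right subtrees of $k$. Then $\psi(\pi)$ is obtained from $T'$ by giving $\ell$ the left child $k-1$ and the right subtree $A$, and giving $k-1$ the leaf $k$ as left child and $B$ as right subtree. **Algorithm C (the map $\psi'$).** Let $\sigma\in\mathcal{DU}_{n,k}$ and $m=\lfloor (n+1)/2\rfloor$. If $n$ is odd, $T^{(m)}$ is the single vertex $\sigma_n$; if $n$ is even, $T^{(m)}$ is the root $\sigma_n$ with left child $\sigma_{n-1}$. For $i=m-1,\dots,1$, let $a$ be the smallest vertex greater than $\sigma_{2i}$ in the minimal path of $T^{(i+1)}$. * (C1) If $a<\sigma_{2i-1}$,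 follow right children from $a$ and let $a=v_1<v_2<\cdots<v_j=b$ be the vertices less than $\sigma_{2i-1}$ on this path. Let $S_1,\dots,S_j$ be the left subtrees of $v_1,\dots,v_j$ and $S_{j+1}$ the right subtree of $v_j$ (possibly empty). In $T^{(i+1)}$ replace the subtree rooted at $a$ by the tree with root $\sigma_{2i}$ whose path of left edges is $\sigma_{2i},v_1,v_2,\dots,v_j,\sigma_{2i-1}$, where $\sigma_{2i},v_1,\dots,v_j$ have right subtrees $S_1,S_2,\dots,S_{j+1}$ respectively and $\sigma_{2i-1}$ is a leaf. * (C2) If $\sigma_{2i-1}<a$, replace the subtree $S$ rooted at $a$ by the tree with root $\sigma_{2i}$, the leaf $\sigma_{2i-1}$ as left child, and $S$ as right subtree. The result is $T^{(i)}$, and $\psi'(\sigma)=T^{(1)}$. **Theorem.** For all $1\le k\le n$, both $\psi$ and $\psi'$ are bijections from $\mathcal{DU}_{n,k}$ to $\mathcal T_{n,k}$, and they are equal: $\psi(\sigma)=\psi'(\sigma)$ for every $\sigma\in\mathcal{DU}_{n,k}$. -/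

import Mathlib

namespace Entringer

/-! ### Alternating permutations

A permutation of `[n] = {1, …, n}` is written as the word `σ₁ σ₂ … σₙ`, a list of natural numbers. -/

/-- `σ₁ > σ₂ < σ₃ > σ₄ < ⋯` (positions in the list are counted from `0`). -/
def IsDownUp (σ : List ℕ) : Prop :=
  ∀ (i : ℕ) (h : i + 1 < σ.length),
    (Even i → σ[i + 1] < σ[i]) ∧ (Odd i → σ[i] < σ[i + 1])

/-- `DU_n`: the (down-up) alternating permutations of `[n]`. -/
def DU (n : ℕ) : Set (List ℕ) :=
  {σ | σ.Perm (List.range' 1 n) ∧ IsDownUp σ}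

/-- `DU_{n,k}`: the alternating permutations of `[n]` with first entry `k`. -/
def DUFirst (n k : ℕ) : Set (List ℕ) :=
  {σ | σ ∈ DU n ∧ σ.head? = some k}

/-! ### Increasing 1-2 trees

An increasing 1-2 tree is a rooted tree with distinct vertex labels, at most two children at every
vertex, and labels increasing along every path from the root.  It is drawn as a binary tree by the
convention that an only child is a left child, and that of two siblings the smaller one is the left
child.  Each increasing 1-2 tree has exactly one such drawing, and this is how it is represented;
`nil` is the empty (sub)tree. -/

open BinaryTree

/-- The list of all vertex labels of a tree. -/
def labels : BinaryTree ℕ → List ℕ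
  | nil => []
  | node v l r => v :: (labels l ++ labels r)

/-- The label of the root, if the tree is not empty. -/
def root? : BinaryTree ℕ → Option ℕ
  | nil => none
  | node v _ _ => some v

/-- The tree with a single vertex. -/
def leaf (v : ℕ) : BinaryTree ℕ := node v nil nil

/-- The conditions on a binary tree to be the drawing of an increasing 1-2 tree (or empty):
labels increase away from the root, and a right child has a smaller left sibling. -/
def IsIncreasing : BinaryTree ℕ → Prop
  | nil => True
  | node v l r =>
      (∀ x ∈ labels l, v < x) ∧ (∀ x ∈ labels r, v < x) ∧
      (∀ y, root? r = some y → ∃ x, root? l = some x ∧ x < y) ∧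
      IsIncreasing l ∧ IsIncreasing r

/-- `T_n`: the increasing 1-2 trees on `[n]`. -/
def Trees (n : ℕ) : Set (BinaryTree ℕ) :=
  {t | (labels t).Perm (List.range' 1 n) ∧ IsIncreasing t}

/-- The minimal path: start at the root and go to the left child until there is none. -/
def minPath : BinaryTree ℕ → List ℕ
  | nil => []
  | node v l _ => v :: minPath l

/-- The minimal leaf: the last vertex of the minimal path. -/
def minLeaf? (t : BinaryTree ℕ) : Option ℕ := (minPath t).getLast?

/-- `T_{n,k}`: the increasing 1-2 trees on `[n]` with minimal leaf `k`. -/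
def TreesLeaf (n k : ℕ) : Set (BinaryTree ℕ) :=
  {t | t ∈ Trees n ∧ minLeaf? t = some k}

/-- Go up the minimal path to its first vertex with a label greater than `c` and replace the whole
subtree `S` rooted at that vertex by `f S`.  Since labels increase along the minimal path, that
vertex is the smallest one greater than `c` in the minimal path. -/
def modifyMinPath (c : ℕ) (f : BinaryTree ℕ → BinaryTree ℕ) : BinaryTree ℕ → BinaryTree ℕ
  | nil => nil
  | node v l r => if c < v then f (node v l r) else node v (modifyMinPath c f l) r

/-! ### Algorithm B: the recursive map `ψ` -/

/-- The relabelling of `[n] ∖ {k-1, k}` by `[n-2]`. -/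
def relabelDown (k x : ℕ) : ℕ := if x < k - 1 then x else x - 2

/-- The relabelling of `[n-2]` by `[n] ∖ {k-1, k}`. -/
def relabelUp (k x : ℕ) : ℕ := if x < k - 1 then x else x + 2

/-- With `m` the smallest vertex greater than `k` in the minimal path, insert `k-1` in the middle of
the edge from the parent of `m` to `m` (as the new root if `m` is the root), and graft `k`
as the left child of `k-1`; thus `m` becomes the right child of `k-1`. -/
def insertB (k : ℕ) (t : BinaryTree ℕ) : BinaryTree ℕ :=
  modifyMinPath k (fun S => node (k - 1) (leaf k) S) t

/-- `x` is the left child and `y` is the right child of one vertex of the tree. -/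
def AreSiblings (x y : ℕ) : BinaryTree ℕ → Prop
  | nil => False
  | node _ l r =>
      (root? l = some x ∧ root? r = some y) ∨ AreSiblings x y l ∨ AreSiblings x y r

instance decidableAreSiblings (x y : ℕ) : ∀ t, Decidable (AreSiblings x y t)
  | nil => isFalse (fun h => h)
  | node _ l r =>
      haveI := decidableAreSiblings x y l
      haveI := decidableAreSiblings x y r
      inferInstanceAs (Decidable
        ((root? l = some x ∧ root? r = some y) ∨ AreSiblings x y l ∨ AreSiblings x y r))

/-- At the vertex `ℓ` whose left child is the leaf `k-1` and whose right child is `k`, where `k` has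
left subtree `A` and right subtree `B`: make `k` a leaf and the left child of `k-1`, make `B` the
right subtree of `k-1`, and make `A` the right subtree of `ℓ`. -/
def siblingMove (k : ℕ) : BinaryTree ℕ → BinaryTree ℕ
  | nil => nil
  | node v l r =>
      if root? l = some (k - 1) ∧ root? r = some k then
        node v (node (k - 1) (leaf k) r.right) r.left
      else node v (siblingMove k l) (siblingMove k r)

/-- The map `ψ`.  The branches for the empty word and for `π₂ ≥ π₁` are never used on an alternating
permutation of `[n]` with `n ≥ 1`. -/
def psi : List ℕ → BinaryTree ℕ
  | [] => nil
  | [_] => leaf 1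
  | [_, _] => node 1 (leaf 2) nil
  | k :: y :: z :: rest =>
      if y + 1 = k then
        insertB k ((psi ((z :: rest).map (relabelDown k))).map (relabelUp k))
      else if h : y + 1 < k then
        let t := psi ((k :: y :: z :: rest).map (Equiv.swap (k - 1) k))
        if AreSiblings (k - 1) k t then siblingMove k t
        else t.map (Equiv.swap (k - 1) k)
      else nil
termination_by σ => (σ.length, σ.headD 0)
decreasing_by
  · simp [Prod.lex_def]
  · have : k - 1 < k := by omega
    simpa [Prod.lex_def] using this

/-! ### Algorithm C: the direct map `ψ'` -/

/-- For a tree with maximal path (root, right child of the root, its right child, …)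
`v₁ < v₂ < ⋯`, let `v₁, …, v_j` be its vertices less than `x` (with `v₁ < x`), `S₁, …, S_j` their
left subtrees and `S_{j+1}` the right subtree of `v_j`.  The result is the path of left edges
`v₁, …, v_j, x` with `S₂, …, S_{j+1}` as the right subtrees of `v₁, …, v_j`; the tree `S₁` is
dropped. -/
def flipPath (x : ℕ) : BinaryTree ℕ → BinaryTree ℕ
  | nil => nil
  | node v _ nil => node v (leaf x) nil
  | node v _ (node w l r) =>
      if w < x then node v (flipPath x (node w l r)) l
      else node v (leaf x) (node w l r)

/-- What happens to the subtree `S` with root `a`, where `a` is the smallest vertex greater than `y`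
in the minimal path, when the pair `(x, y)` is read.

If `a < x`, then `y` takes the place of `a`, with the flipped path `a = v₁, …, v_j = b, x` as left
subtree and the left subtree `S₁` of `a` as right subtree.
If `x < a`, then `y` takes the place of `a`, with the leaf `x` as left and `S` as right subtree. -/
def graftPair (x y : ℕ) : BinaryTree ℕ → BinaryTree ℕ
  | nil => nil
  | node a l r =>
      if a < x then node y (flipPath x (node a l r)) l
      else node y (leaf x) (node a l r)

/-- The map `ψ'`: read the pairs `(σ₁, σ₂), (σ₃, σ₄), …` from right to left, starting from the tree
of the last pair (or of the last letter, if the length is odd). -/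
def psi' : List ℕ → BinaryTree ℕ
  | [] => nil
  | [x] => leaf x
  | [x, y] => node y (leaf x) nil
  | x :: y :: z :: rest => modifyMinPath y (graftPair x y) (psi' (z :: rest))

end Entringer

/-!
Both algorithms compute the tree obtained by reading the pairs `(σ₁, σ₂), (σ₃, σ₄), …` from right to
left and *grafting* each of them onto the tree built so far.

Grafting `(x, y)` descends along the minimal path to the place of `y`. If the vertex `v` found there
is greater than `x`, its subtree is hung next to the new leaf `x`; otherwise `y` pushes `v` into the
right subtree of `v`, where `v` is grafted together with `x` in the same way, and `y` takes over the
left subtree of `v` as its right one. Read backwards, a vertex of the new minimal path comes from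
one of two trees, which differ in the order of two siblings; only one of them is increasing, so
grafting can be undone, and folding it over words is a bijection. Algorithm C is this fold, since
flipping a path of right edges amounts to the repeated pushing.

For Algorithm B, grafting commutes with every relabelling which preserves the order. Exchanging
`k-1` and `k` preserves all comparisons made during a graft except the one between these two
letters, which happens exactly when they become siblings, and there the sibling rule of (B2) makes
the correction.
-/

namespace Entringer

open BinaryTree

/-- The label of the root, with the value `⊤` on the empty tree, so that the order of siblings and
the growth along edges are both comparisons of root labels. -/
def rootLabel : BinaryTree ℕ → ℕ∞
  | nil => ⊤
  | node v _ _ => v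

theorem root?_eq_some_iff {t : BinaryTree ℕ} {a : ℕ} : root? t = some a ↔ rootLabel t = a := by
  cases t <;> simp [root?, rootLabel]

theorem lt_rootLabel_iff {t : BinaryTree ℕ} (ht : IsIncreasing t) {v : ℕ} :
    v < rootLabel t ↔ ∀ a ∈ labels t, v < a := by
  cases t with
  | nil => simp [rootLabel, labels]
  | node w l r =>
    simp only [rootLabel, labels, List.forall_mem_cons, List.forall_mem_append, Nat.cast_lt]
    exact ⟨fun h => ⟨h, fun a ha => h.trans (ht.1 a ha), fun a ha => h.trans (ht.2.1 a ha)⟩,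
      fun h => h.1⟩

theorem isIncreasing_node {v : ℕ} {l r : BinaryTree ℕ} :
    IsIncreasing (node v l r) ↔
      v < rootLabel l ∧ (rootLabel l < rootLabel r ∨ r = nil) ∧
        IsIncreasing l ∧ IsIncreasing r := by
  have siblings_iff : (∀ y, root? r = some y → ∃ x, root? l = some x ∧ x < y) ↔
      rootLabel l < rootLabel r ∨ r = nil := by
    cases l <;> cases r <;> simp [root?, rootLabel]
  rw [IsIncreasing, siblings_iff]
  constructor
  · rintro ⟨hvl, -, hlr, hl, hr⟩
    exact ⟨(lt_rootLabel_iff hl).2 hvl, hlr, hl, hr⟩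
  · rintro ⟨hvl, hlr, hl, hr⟩
    refine ⟨(lt_rootLabel_iff hl).1 hvl, (lt_rootLabel_iff hr).1 ?_, hlr, hl, hr⟩
    rcases hlr with hlr | rfl
    · exact hvl.trans hlr
    · exact ENat.natCast_lt_top v

theorem mem_labels_of_rootLabel_eq {t : BinaryTree ℕ} {a : ℕ} (h : rootLabel t = a) :
    a ∈ labels t := by
  cases t <;> simp_all [rootLabel, labels]

theorem eq_nil_of_rootLabel_eq {l r : BinaryTree ℕ} (hlr : (labels l).Disjoint (labels r))
    (h : rootLabel l = rootLabel r) : l = nil := by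
  cases l with
  | nil => rfl
  | node a _ _ =>
    exact absurd (mem_labels_of_rootLabel_eq h.symm) (hlr (mem_labels_of_rootLabel_eq rfl))

theorem isIncreasing_leaf (x : ℕ) : IsIncreasing (leaf x) := by
  simp [leaf, IsIncreasing, labels, root?]

theorem minLeaf?_node (v : ℕ) (l r : BinaryTree ℕ) :
    minLeaf? (node v l r) = some ((minLeaf? l).getD v) :=
  List.getLast?_cons

theorem minLeaf?_eq_none_iff {t : BinaryTree ℕ} : minLeaf? t = none ↔ t = nil := by
  cases t <;> simp [minLeaf?, minPath]

theorem minLeaf?_node_of_ne_nil {l : BinaryTree ℕ} (hl : l ≠ nil) (v : ℕ) (r : BinaryTree ℕ) :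
    minLeaf? (node v l r) = minLeaf? l := by
  obtain ⟨a, ha⟩ := Option.ne_none_iff_exists'.1 (mt minLeaf?_eq_none_iff.1 hl)
  simp [minLeaf?_node, ha]

theorem mem_labels_of_mem_minLeaf? {t : BinaryTree ℕ} {a : ℕ} (h : a ∈ minLeaf? t) :
    a ∈ labels t := by
  induction t with
  | nil => simp [minLeaf?, minPath] at h
  | node v l r ihl _ =>
    rw [minLeaf?_node, Option.mem_some_iff] at h
    cases hl : minLeaf? l with
    | none => simp_all [labels]
    | some b => simp_all [labels]

/-! ### Grafting a pair of letters -/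

/-- One step of Algorithm C, in which the flipped path is produced by the same recursion as the
descent along the minimal path: where `y` takes the place of a vertex `v < x`, the vertex `v` is in
turn inserted, together with `x`, into the right subtree of `v`. -/
def graft (x y : ℕ) : BinaryTree ℕ → BinaryTree ℕ
  | nil => node y (leaf x) nil
  | node v l r =>
      if v < y then node v (graft x y l) r
      else if v < x then node y (graft x v r) l
      else node y (leaf x) (node v l r)

/-- The pair `x > y` of new letters can be grafted onto the increasing tree `t`: the smaller letter
`y` lies below the minimal leaf of `t`, so that it finds its place on the minimal path. -/
structure Graftable (x y : ℕ) (t : BinaryTree ℕ) : Prop where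
  lt : y < x
  lt_minLeaf : ∀ z ∈ minLeaf? t, y < z
  nodup : (x :: y :: labels t).Nodup
  isIncreasing : IsIncreasing t

variable {x y v : ℕ} {l r t : BinaryTree ℕ}

namespace Graftable

theorem ne_root (h : Graftable x y (node v l r)) : v ≠ x ∧ v ≠ y := by
  have := h.nodup
  grind [labels]

theorem left_ne_nil (h : Graftable x y (node v l r)) (hv : v < y) : l ≠ nil := by
  rintro rfl
  exact hv.not_gt (h.lt_minLeaf v rfl)

theorem left (h : Graftable x y (node v l r)) : Graftable x y l where
  lt := h.lt
  lt_minLeaf z hz := h.lt_minLeaf z (by rw [minLeaf?_node, Option.mem_def.1 hz]; rfl)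
  nodup := h.nodup.sublist (by simp [labels])
  isIncreasing := h.isIncreasing.2.2.2.1

theorem right (h : Graftable x y (node v l r)) (hv : v < x) : Graftable x v r where
  lt := hv
  lt_minLeaf z hz := h.isIncreasing.2.1 z (mem_labels_of_mem_minLeaf? hz)
  nodup := h.nodup.sublist (by simp [labels])
  isIncreasing := h.isIncreasing.2.2.2.2

end Graftable

theorem labels_graft (x y : ℕ) (t : BinaryTree ℕ) :
    (labels (graft x y t)).Perm (x :: y :: labels t) := by
  induction t generalizing y with
  | nil => exact List.Perm.swap x y []
  | node v l r ihl ihr =>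
    have countl := fun a => (ihl y).count_eq a
    have countr := fun a => (ihr v).count_eq a
    simp only [graft]
    split_ifs <;> rw [List.perm_iff_count] <;> intro a <;>
      simp only [labels, leaf, List.count_cons, List.count_append, List.count_nil, countl,
        countr] <;>
      omega

theorem graft_ne_nil (x y : ℕ) (t : BinaryTree ℕ) : graft x y t ≠ nil := by
  intro h
  simpa [h, labels] using (labels_graft x y t).length_eq

theorem graft_ne_leaf (x y a : ℕ) (t : BinaryTree ℕ) : graft x y t ≠ leaf a := by
  intro h
  simpa [h, labels, leaf] using (labels_graft x y t).length_eq

theorem rootLabel_graft (x y : ℕ) (t : BinaryTree ℕ) :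
    rootLabel (graft x y t) = min (y : ℕ∞) (rootLabel t) := by
  cases t with
  | nil => simp [graft, rootLabel]
  | node v l r =>
    simp only [graft, rootLabel]
    split_ifs with hvy hvx
    · exact (min_eq_right (Nat.cast_le.2 hvy.le)).symm
    · exact (min_eq_left (Nat.cast_le.2 (not_lt.1 hvy))).symm
    · exact (min_eq_left (Nat.cast_le.2 (not_lt.1 hvy))).symm

theorem minLeaf?_graft (x y : ℕ) (t : BinaryTree ℕ) : minLeaf? (graft x y t) = some x := by
  induction t generalizing y with
  | nil => rfl
  | node v l r ihl ihr =>
    simp only [graft]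
    split_ifs <;> simp [minLeaf?_node, minLeaf?_eq_none_iff.2, leaf, ihl, ihr]

theorem graft_of_lt_rootLabel (hyx : y < x) (hx : x < rootLabel t) :
    graft x y t = node y (leaf x) t := by
  cases t with
  | nil => rfl
  | node v l r =>
    have hxv : x < v := Nat.cast_lt.1 hx
    rw [graft, if_neg (by omega), if_neg (by omega)]

theorem isIncreasing_graft (h : Graftable x y t) : IsIncreasing (graft x y t) := by
  induction t generalizing y with
  | nil => exact isIncreasing_node.2 ⟨Nat.cast_lt.2 h.lt, .inr rfl, isIncreasing_leaf x, trivial⟩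
  | node v l r ihl ihr =>
    obtain ⟨hvl, hlr, hl, hr⟩ := isIncreasing_node.1 h.isIncreasing
    obtain ⟨hvx, hvy⟩ := h.ne_root
    simp only [graft]
    split_ifs with hlty hltx
    · refine isIncreasing_node.2 ⟨?_, ?_, ihl h.left, hr⟩ <;> rw [rootLabel_graft]
      · exact lt_min (Nat.cast_lt.2 hlty) hvl
      · exact hlr.imp_left (min_le_right _ _).trans_lt
    · have hyv : (y : ℕ∞) < v := Nat.cast_lt.2 (by omega)
      have hvr : (v : ℕ∞) < rootLabel r := (lt_rootLabel_iff hr).2 h.isIncreasing.2.1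
      refine isIncreasing_node.2 ⟨?_, .inl ?_, ihr (h.right hltx), hl⟩ <;> rw [rootLabel_graft]
      · exact lt_min hyv (hyv.trans hvr)
      · exact (min_le_left _ _).trans_lt hvl
    · exact isIncreasing_node.2 ⟨Nat.cast_lt.2 h.lt, .inl (Nat.cast_lt.2 (by omega)),
        isIncreasing_leaf x, h.isIncreasing⟩

theorem graft_eq_node (h : graft x y t = node v l r) :
    (l = leaf x ∧ y = v ∧ t = r) ∨
      (∃ s, graft x y s = l ∧ v < y ∧ t = node v s r) ∨
      ∃ w s, graft x w s = l ∧ w < x ∧ y = v ∧ t = node w r s := by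
  cases t with
  | nil => grind [graft]
  | node a b c =>
    rw [graft] at h
    grind

theorem not_isIncreasing_both_orders {a b : ℕ} (hl : l ≠ nil) (hlr : IsIncreasing (node a l r)) :
    ¬IsIncreasing (node b r l) := by
  intro hrl
  rcases (isIncreasing_node.1 hlr).2.1 with hlt | rfl
  · exact (isIncreasing_node.1 hrl).2.1.elim hlt.not_gt hl
  · exact (isIncreasing_node.1 hrl).2.1.elim not_top_lt hl

theorem Graftable.graft_injective {y' : ℕ} {t' : BinaryTree ℕ} (h : Graftable x y t)
    (h' : Graftable x y' t') (heq : graft x y t = graft x y' t') : y = y' ∧ t = t' := by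
  generalize hu : graft x y t = u at heq
  induction u generalizing y y' t t' with
  | nil => exact absurd hu (graft_ne_nil x y t)
  | node v l r ihl _ =>
    rcases graft_eq_node hu with
        ⟨rfl, rfl, rfl⟩ | ⟨s, rfl, hvy, rfl⟩ | ⟨w, s, rfl, hwx, rfl, rfl⟩ <;>
      rcases graft_eq_node heq.symm with
        ⟨hl, rfl, rfl⟩ | ⟨s', hl, hvy', rfl⟩ | ⟨w', s', hl, hwx', rfl, rfl⟩
    · exact ⟨rfl, rfl⟩
    · exact absurd hl (graft_ne_leaf _ _ _ _)
    · exact absurd hl (graft_ne_leaf _ _ _ _)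
    · exact absurd hl (graft_ne_leaf _ _ _ _)
    · obtain ⟨rfl, rfl⟩ := ihl h.left h'.left rfl hl.symm
      exact ⟨rfl, rfl⟩
    · obtain ⟨rfl, rfl⟩ := ihl h.left (h'.right hwx') rfl hl.symm
      exact absurd h'.isIncreasing
        (not_isIncreasing_both_orders (h.left_ne_nil hvy) h.isIncreasing)
    · exact absurd hl (graft_ne_leaf _ _ _ _)
    · obtain ⟨rfl, rfl⟩ := ihl (h.right hwx) h'.left rfl hl.symm
      exact absurd h.isIncreasing
        (not_isIncreasing_both_orders (h'.left_ne_nil hvy') h'.isIncreasing)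
    · obtain ⟨rfl, rfl⟩ := ihl (h.right hwx) (h'.right hwx') rfl hl.symm
      exact ⟨rfl, rfl⟩

theorem exists_graft_leaf_eq (hinc : IsIncreasing (node v (leaf x) r))
    (hnd : (labels (node v (leaf x) r)).Nodup) :
    ∃ y s, Graftable x y s ∧ graft x y s = node v (leaf x) r := by
  obtain ⟨hvx, hxr, -, hr⟩ := isIncreasing_node.1 hinc
  have hlt : v < x := Nat.cast_lt.1 hvx
  have heq : graft x v r = node v (leaf x) r := by
    rcases hxr with hxr | rfl
    · exact graft_of_lt_rootLabel hlt hxr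
    · rfl
  refine ⟨v, r, ⟨hlt, ?_, ?_, hr⟩, heq⟩
  · exact fun z hz => hinc.2.1 z (mem_labels_of_mem_minLeaf? hz)
  · rwa [← (labels_graft x v r).nodup_iff, heq]

theorem Graftable.exists_graft_eq_node {s : BinaryTree ℕ} (h : Graftable x y s)
    (hinc : IsIncreasing (node v (graft x y s) r))
    (hnd : (labels (node v (graft x y s) r)).Nodup) :
    ∃ w u, Graftable x w u ∧ graft x w u = node v (graft x y s) r := by
  obtain ⟨hv, hr, -, hincr⟩ := isIncreasing_node.1 hinc
  rw [rootLabel_graft] at hv hr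
  have hvy : v < y := Nat.cast_lt.1 (hv.trans_le (min_le_left _ _))
  have hvs : (v : ℕ∞) < rootLabel s := hv.trans_le (min_le_right _ _)
  have hdisj : (labels s).Disjoint (labels r) :=
    fun a ha => List.disjoint_of_nodup_append hnd.of_cons
      ((labels_graft x y s).mem_iff.2 (List.mem_cons_of_mem _ (List.mem_cons_of_mem _ ha)))
  rcases lt_or_ge (rootLabel s) (rootLabel r) with hsr | hrs
  · have heq : graft x y (node v s r) = node v (graft x y s) r := by rw [graft, if_pos hvy]
    have hs : s ≠ nil := by
      rintro rfl
      exact not_top_lt hsr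
    refine ⟨y, node v s r, ⟨h.lt, ?_, ?_, ?_⟩, heq⟩
    · rw [minLeaf?_node_of_ne_nil hs]
      exact h.lt_minLeaf
    · rwa [← (labels_graft x y _).nodup_iff, heq]
    · exact isIncreasing_node.2 ⟨hvs, .inl hsr, h.isIncreasing, hincr⟩
  · have heq : graft x v (node y r s) = node v (graft x y s) r := by
      rw [graft, if_neg hvy.not_gt, if_pos h.lt]
    have hyr : y < rootLabel r := by
      rcases hr with hr | rfl
      · exact (min_lt_iff.1 hr).resolve_right hrs.not_gt
      · exact ENat.natCast_lt_top y
    have hinc' : IsIncreasing (node y r s) := isIncreasing_node.2 ⟨hyr,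
      hrs.lt_or_eq.imp_right fun e => eq_nil_of_rootLabel_eq hdisj e.symm, hincr, h.isIncreasing⟩
    refine ⟨v, node y r s, ⟨hvy.trans h.lt, ?_, ?_, hinc'⟩, heq⟩
    · exact fun z hz => (lt_rootLabel_iff hinc').1 (Nat.cast_lt.2 hvy) z
        (mem_labels_of_mem_minLeaf? hz)
    · rwa [← (labels_graft x v _).nodup_iff, heq]

theorem exists_graft_eq (hinc : IsIncreasing t) (hnd : (labels t).Nodup) (hx : minLeaf? t = some x)
    (hne : t ≠ leaf x) : ∃ y s, Graftable x y s ∧ graft x y s = t := by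
  induction t with
  | nil => simp [minLeaf?, minPath] at hx
  | node v l r ihl _ =>
    obtain ⟨hvl, hlr, hl, hr⟩ := isIncreasing_node.1 hinc
    have hl_ne : l ≠ nil := by
      rintro rfl
      obtain rfl : r = nil := hlr.resolve_left not_top_lt
      obtain rfl : v = x := Option.some_inj.1 hx
      exact hne rfl
    rw [minLeaf?_node_of_ne_nil hl_ne] at hx
    by_cases hleaf : l = leaf x
    · subst hleaf
      exact exists_graft_leaf_eq hinc hnd
    · obtain ⟨y, s, h, rfl⟩ := ihl hl (hnd.sublist (by simp [labels])) hx hleaf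
      exact h.exists_graft_eq_node hinc hnd

/-! ### The tree of a word -/

/-- The tree obtained from a word by grafting the pairs `(σ₁, σ₂), (σ₃, σ₄), …` from right to left.
Both algorithms compute this tree on alternating permutations. -/
def wordTree : List ℕ → BinaryTree ℕ
  | [] => nil
  | [x] => leaf x
  | x :: y :: τ => graft x y (wordTree τ)

/-- The words with distinct letters which are down-up alternating. -/
def downUpWords : Set (List ℕ) := {σ | σ.Nodup ∧ IsDownUp σ}

/-- The increasing 1-2 trees, on an arbitrary finite set of labels, including the empty tree. -/
def increasingTrees : Set (BinaryTree ℕ) := {t | (labels t).Nodup ∧ IsIncreasing t}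

theorem isDownUp_of_length_le_one {σ : List ℕ} (hσ : σ.length ≤ 1) : IsDownUp σ :=
  fun i hi => by omega

theorem isDownUp_cons_cons {τ : List ℕ} :
    IsDownUp (x :: y :: τ) ↔ y < x ∧ (∀ z ∈ τ.head?, y < z) ∧ IsDownUp τ := by
  constructor
  · refine fun h => ⟨(h 0 (by simp)).1 Even.zero, fun z hz => ?_, fun i hi => ?_⟩
    · obtain ⟨τ, rfl⟩ := List.head?_eq_some_iff.1 hz
      exact (h 1 (by simp)).2 odd_one
    · have hi' : i + 2 + 1 < (x :: y :: τ).length := by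
        simp only [List.length_cons]
        omega
      simpa [Nat.even_add, Nat.odd_add] using h (i + 2) hi'
  · rintro ⟨hyx, hyz, hτ⟩ i hi
    match i with
    | 0 => simpa using hyx
    | 1 =>
      cases τ with
      | nil => simp at hi
      | cons z τ => simpa using hyz
    | i + 2 =>
      have hi' : i + 1 < τ.length := by
        simp only [List.length_cons] at hi
        omega
      simpa [Nat.even_add, Nat.odd_add] using hτ i hi'

theorem labels_wordTree (σ : List ℕ) : (labels (wordTree σ)).Perm σ := by
  induction σ using List.twoStepInduction with
  | nil => rfl
  | singleton x => rfl
  | cons_cons x y τ ih _ => exact (labels_graft x y _).trans ((ih.cons y).cons x)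

theorem minLeaf?_wordTree (σ : List ℕ) : minLeaf? (wordTree σ) = σ.head? := by
  match σ with
  | [] => rfl
  | [x] => rfl
  | x :: y :: τ => exact minLeaf?_graft x y _

theorem graftable_wordTree_iff {τ : List ℕ} (hτ : IsDownUp τ) (hinc : IsIncreasing (wordTree τ)) :
    Graftable x y (wordTree τ) ↔ x :: y :: τ ∈ downUpWords := by
  have hnodup : (x :: y :: labels (wordTree τ)).Nodup ↔ (x :: y :: τ).Nodup :=
    (((labels_wordTree τ).cons y).cons x).nodup_iff
  constructor
  · exact fun h => ⟨hnodup.1 h.nodup,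
      isDownUp_cons_cons.2 ⟨h.lt, minLeaf?_wordTree τ ▸ h.lt_minLeaf, hτ⟩⟩
  · rintro ⟨hnd, hdu⟩
    obtain ⟨hlt, hhead, -⟩ := isDownUp_cons_cons.1 hdu
    exact ⟨hlt, (minLeaf?_wordTree τ).symm ▸ hhead, hnodup.2 hnd, hinc⟩

theorem tail_tail_mem_downUpWords {τ : List ℕ} (h : x :: y :: τ ∈ downUpWords) :
    τ ∈ downUpWords :=
  ⟨h.1.of_cons.of_cons, (isDownUp_cons_cons.1 h.2).2.2⟩

theorem isIncreasing_wordTree {σ : List ℕ} (hσ : σ ∈ downUpWords) : IsIncreasing (wordTree σ) := by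
  induction σ using List.twoStepInduction with
  | nil => trivial
  | singleton x => exact isIncreasing_leaf x
  | cons_cons x y τ ih _ =>
    have hτ := tail_tail_mem_downUpWords hσ
    exact isIncreasing_graft ((graftable_wordTree_iff hτ.2 (ih hτ)).2 hσ)

theorem graftable_wordTree {τ : List ℕ} (h : x :: y :: τ ∈ downUpWords) :
    Graftable x y (wordTree τ) :=
  have hτ := tail_tail_mem_downUpWords h
  (graftable_wordTree_iff hτ.2 (isIncreasing_wordTree hτ)).2 h

theorem length_eq_of_wordTree_eq {σ τ : List ℕ} (h : wordTree σ = wordTree τ) :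
    σ.length = τ.length := by
  rw [← (labels_wordTree σ).length_eq, h, (labels_wordTree τ).length_eq]

theorem head?_eq_of_wordTree_eq {σ τ : List ℕ} (h : wordTree σ = wordTree τ) :
    σ.head? = τ.head? := by
  rw [← minLeaf?_wordTree, h, minLeaf?_wordTree]

theorem injOn_wordTree : Set.InjOn wordTree downUpWords := by
  intro σ hσ τ hτ heq
  have hlen := length_eq_of_wordTree_eq heq
  induction σ using List.twoStepInduction generalizing τ with
  | nil => exact (List.length_eq_zero_iff.1 hlen.symm).symm
  | singleton x =>
    obtain ⟨a, rfl⟩ := List.length_eq_one_iff.1 hlen.symm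
    rw [Option.some_inj.1 (head?_eq_of_wordTree_eq heq)]
  | cons_cons x y σ ih _ =>
    match τ with
    | a :: b :: τ =>
      obtain rfl : x = a := Option.some_inj.1 (head?_eq_of_wordTree_eq heq)
      obtain ⟨rfl, htree⟩ := (graftable_wordTree hσ).graft_injective (graftable_wordTree hτ) heq
      rw [ih (tail_tail_mem_downUpWords hσ) (tail_tail_mem_downUpWords hτ) htree
        (length_eq_of_wordTree_eq htree)]

theorem exists_wordTree_eq (ht : t ∈ increasingTrees) : ∃ σ ∈ downUpWords, wordTree σ = t := by
  induction hn : (labels t).length using Nat.strong_induction_on generalizing t with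
  | _ n ih =>
    subst hn
    cases hx : minLeaf? t with
    | none =>
      obtain rfl := minLeaf?_eq_none_iff.1 hx
      exact ⟨[], ⟨List.nodup_nil, isDownUp_of_length_le_one (Nat.zero_le 1)⟩, rfl⟩
    | some x =>
      by_cases hleaf : t = leaf x
      · exact ⟨[x], ⟨List.nodup_singleton x, isDownUp_of_length_le_one le_rfl⟩, hleaf.symm⟩
      obtain ⟨y, s, h, rfl⟩ := exists_graft_eq ht.2 ht.1 hx hleaf
      have hlt : (labels s).length < (labels (graft x y s)).length := by
        simp [(labels_graft x y s).length_eq]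
      obtain ⟨τ, hτ, rfl⟩ := ih _ hlt ⟨h.nodup.of_cons.of_cons, h.isIncreasing⟩ rfl
      exact ⟨x :: y :: τ, (graftable_wordTree_iff hτ.2 h.isIncreasing).1 h, rfl⟩

theorem bijOn_wordTree : Set.BijOn wordTree downUpWords increasingTrees :=
  ⟨fun σ hσ => ⟨(labels_wordTree σ).nodup_iff.2 hσ.1, isIncreasing_wordTree hσ⟩, injOn_wordTree,
    fun _ ht => exists_wordTree_eq ht⟩

theorem bijOn_wordTree_DUFirst (n k : ℕ) :
    Set.BijOn wordTree (DUFirst n k) (TreesLeaf n k) := by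
  have nodup {w : List ℕ} (h : w.Perm (List.range' 1 n)) : w.Nodup :=
    h.nodup_iff.2 List.nodup_range'
  have hsub : DUFirst n k ⊆ downUpWords := fun σ hσ => ⟨nodup hσ.1.1, hσ.1.2⟩
  refine ⟨fun σ hσ => ?_, bijOn_wordTree.injOn.mono hsub, ?_⟩
  · exact ⟨⟨(labels_wordTree σ).trans hσ.1.1, (bijOn_wordTree.mapsTo (hsub hσ)).2⟩,
      (minLeaf?_wordTree σ).trans hσ.2⟩
  · rintro t ⟨⟨hperm, hinc⟩, hleaf⟩
    obtain ⟨σ, hσ, rfl⟩ := bijOn_wordTree.surjOn ⟨nodup hperm, hinc⟩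
    exact ⟨σ, ⟨⟨(labels_wordTree σ).symm.trans hperm, hσ.2⟩,
      (minLeaf?_wordTree σ).symm.trans hleaf⟩, rfl⟩

/-! ### Algorithm C -/

theorem modifyMinPath_eq_graft {c : ℕ} {f : BinaryTree ℕ → BinaryTree ℕ}
    (h : Graftable x y t) (ht : t ≠ nil) (hc : ∀ a ∈ labels t, c < a ↔ y < a)
    (hf : ∀ v l r, Graftable x y (node v l r) → y < v →
      f (node v l r) = graft x y (node v l r)) :
    modifyMinPath c f t = graft x y t := by
  induction t with
  | nil => exact absurd rfl ht
  | node v l r ihl _ =>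
    have hcv := hc v (by simp [labels])
    rw [modifyMinPath]
    rcases lt_or_gt_of_ne h.ne_root.2 with hvy | hyv
    · rw [if_neg (mt hcv.1 hvy.not_gt), graft, if_pos hvy,
        ihl h.left (h.left_ne_nil hvy) fun a ha => hc a (by simp [labels, ha])]
    · rw [if_pos (hcv.2 hyv), hf v l r h hyv]

theorem flipPath_eq_graft (h : IsIncreasing (node v l r)) :
    flipPath x (node v l r) = graft x v r := by
  induction r generalizing v l with
  | nil => rfl
  | node w l' r' _ ih =>
    have hvw : v < w := h.2.1 w (by simp [labels])
    rw [flipPath, graft, if_neg hvw.not_gt, ih h.2.2.2.2]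

theorem modifyMinPath_graftPair (h : Graftable x y t) (ht : t ≠ nil) :
    modifyMinPath y (graftPair x y) t = graft x y t := by
  refine modifyMinPath_eq_graft h ht (fun _ _ => Iff.rfl) fun v l r h hyv => ?_
  rw [graftPair, flipPath_eq_graft h.isIncreasing, graft, if_neg hyv.not_gt]

theorem wordTree_cons_ne_nil (z : ℕ) (τ : List ℕ) : wordTree (z :: τ) ≠ nil := by
  rw [Ne, ← minLeaf?_eq_none_iff, minLeaf?_wordTree]
  exact Option.some_ne_none z

theorem psi'_eq_wordTree {σ : List ℕ} (hσ : σ ∈ downUpWords) : psi' σ = wordTree σ := by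
  induction σ using psi'.induct with
  | case1 => rfl
  | case2 x => rfl
  | case3 x y => rfl
  | case4 x y z τ ih =>
    rw [psi', ih (tail_tail_mem_downUpWords hσ), wordTree,
      modifyMinPath_graftPair (graftable_wordTree hσ) (wordTree_cons_ne_nil z τ)]

/-! ### Relabelling -/

theorem map_eq_self {f : ℕ → ℕ} (h : ∀ a ∈ labels t, f a = a) : t.map f = t := by
  induction t with
  | nil => rfl
  | node v l r ihl ihr =>
    simp only [labels, List.forall_mem_cons, List.forall_mem_append] at h
    rw [BinaryTree.map, h.1, ihl h.2.1, ihr h.2.2]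

theorem graft_map {f : ℕ → ℕ} (hf : StrictMonoOn f {a | a ∈ x :: y :: labels t}) :
    graft (f x) (f y) (t.map f) = (graft x y t).map f := by
  induction t generalizing y with
  | nil => rfl
  | node v l r ihl ihr =>
    have hv : v ∈ x :: y :: labels (node v l r) := by simp [labels]
    have hvy := hf.lt_iff_lt hv (show y ∈ x :: y :: labels (node v l r) by simp)
    have hvx := hf.lt_iff_lt hv (show x ∈ x :: y :: labels (node v l r) by simp)
    have hl := ihl (y := y) (hf.mono fun a (ha : a ∈ x :: y :: labels l) =>
      show a ∈ x :: y :: labels (node v l r) by grind [labels])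
    have hr := ihr (y := v) (hf.mono fun a (ha : a ∈ x :: v :: labels r) =>
      show a ∈ x :: y :: labels (node v l r) by grind [labels])
    simp only [BinaryTree.map, graft, hvy, hvx, hl, hr]
    split_ifs <;> rfl

theorem wordTree_map {f : ℕ → ℕ} {σ : List ℕ} (hf : StrictMonoOn f {a | a ∈ σ}) :
    wordTree (σ.map f) = (wordTree σ).map f := by
  induction σ using List.twoStepInduction with
  | nil => rfl
  | singleton x => rfl
  | cons_cons x y τ ih _ =>
    have hperm : (x :: y :: labels (wordTree τ)).Perm (x :: y :: τ) :=
      ((labels_wordTree τ).cons y).cons x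
    rw [List.map_cons, List.map_cons, wordTree, wordTree,
      ih (hf.mono fun a ha => List.mem_cons_of_mem _ (List.mem_cons_of_mem _ ha)),
      graft_map (hf.mono fun a ha => hperm.mem_iff.1 ha)]

theorem isDownUp_map_iff {f : ℕ → ℕ} {σ : List ℕ} (hf : StrictMonoOn f {a | a ∈ σ}) :
    IsDownUp (σ.map f) ↔ IsDownUp σ := by
  have lt_iff {i j : ℕ} (hi : i < σ.length) (hj : j < σ.length) :
      f σ[i] < f σ[j] ↔ σ[i] < σ[j] :=
    hf.lt_iff_lt (List.getElem_mem hi) (List.getElem_mem hj)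
  simp only [IsDownUp, List.length_map, List.getElem_map]
  exact forall₂_congr fun i hi => by rw [lt_iff, lt_iff]

theorem map_mem_downUpWords {f : ℕ → ℕ} {σ : List ℕ} (hf : StrictMonoOn f {a | a ∈ σ})
    (hσ : σ ∈ downUpWords) : σ.map f ∈ downUpWords :=
  ⟨(List.nodup_map_iff_inj_on hσ.1).2 fun _ ha _ hb => hf.injOn ha hb, (isDownUp_map_iff hf).2 hσ.2⟩

theorem mem_DU_iff {n : ℕ} {σ : List ℕ} :
    σ ∈ DU n ↔ σ ∈ downUpWords ∧ σ.length = n ∧ ∀ a ∈ σ, 1 ≤ a ∧ a ≤ n := by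
  constructor
  · rintro ⟨hperm, hdu⟩
    refine ⟨⟨hperm.nodup_iff.2 List.nodup_range', hdu⟩, by simpa using hperm.length_eq, ?_⟩
    intro a ha
    have := List.mem_range'_1.1 (hperm.mem_iff.1 ha)
    omega
  · rintro ⟨⟨hnd, hdu⟩, hlen, hbound⟩
    have hsub : σ ⊆ List.range' 1 n := fun a ha =>
      List.mem_range'_1.2 (by have := hbound a ha; omega)
    exact ⟨(hnd.subperm hsub).perm_of_length_le (by simp [hlen]), hdu⟩

/-! ### Algorithm B -/

theorem insertB_eq_graft (h : Graftable (y + 1) y t) (ht : t ≠ nil) :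
    insertB (y + 1) t = graft (y + 1) y t := by
  have hx : y + 1 ∉ labels t := fun hm => by grind [h.nodup]
  refine modifyMinPath_eq_graft h ht (fun a ha => ?_) fun v l r hg hyv => ?_
  · have : a ≠ y + 1 := ne_of_mem_of_not_mem ha hx
    omega
  · have hv : y + 1 < v := by
      have := hg.ne_root.1
      omega
    rw [graft_of_lt_rootLabel h.lt (Nat.cast_lt.2 hv), Nat.add_sub_cancel]

theorem strictMonoOn_relabelDown (y : ℕ) :
    StrictMonoOn (relabelDown (y + 1)) {a | a ≠ y ∧ a ≠ y + 1} := by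
  rintro a ⟨ha, ha'⟩ b ⟨hb, hb'⟩ hab
  simp only [relabelDown]
  split_ifs <;> omega

theorem relabelUp_relabelDown {a : ℕ} (hy : a ≠ y) (hy' : a ≠ y + 1) :
    relabelUp (y + 1) (relabelDown (y + 1) a) = a := by
  simp only [relabelUp, relabelDown]
  split_ifs <;> omega

/-- Step (B2) of Algorithm B, with `k = j + 1`, applied to the tree `T'`. -/
def exchange (j : ℕ) (t : BinaryTree ℕ) : BinaryTree ℕ :=
  if AreSiblings j (j + 1) t then siblingMove (j + 1) t else t.map (Equiv.swap j (j + 1))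

theorem AreSiblings.mem {a b : ℕ} (h : AreSiblings a b t) : a ∈ labels t ∧ b ∈ labels t := by
  induction t with
  | nil => exact h.elim
  | node v l r ihl ihr =>
    simp only [labels, List.mem_cons, List.mem_append]
    rcases h with ⟨hl, hr⟩ | h | h
    · have ha := mem_labels_of_rootLabel_eq (root?_eq_some_iff.1 hl)
      have hb := mem_labels_of_rootLabel_eq (root?_eq_some_iff.1 hr)
      exact ⟨.inr (.inl ha), .inr (.inr hb)⟩
    · exact ⟨.inr (.inl (ihl h).1), .inr (.inl (ihl h).2)⟩
    · exact ⟨.inr (.inr (ihr h).1), .inr (.inr (ihr h).2)⟩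

theorem siblingMove_of_not_areSiblings {j : ℕ} (h : ¬AreSiblings j (j + 1) t) :
    siblingMove (j + 1) t = t := by
  induction t with
  | nil => rfl
  | node v l r ihl ihr =>
    simp only [AreSiblings, not_or] at h
    rw [siblingMove, Nat.add_sub_cancel, if_neg h.1, ihl h.2.1, ihr h.2.2]

theorem swap_succ_of_lt {j a : ℕ} (h : a < j) : Equiv.swap j (j + 1) a = a :=
  Equiv.swap_apply_of_ne_of_ne (by omega) (by omega)

theorem map_swap_eq_self {a b : ℕ} (ha : a ∉ labels t) (hb : b ∉ labels t) :
    t.map (Equiv.swap a b) = t :=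
  map_eq_self fun _ hc => Equiv.swap_apply_of_ne_of_ne (ne_of_mem_of_not_mem hc ha)
    (ne_of_mem_of_not_mem hc hb)

theorem exchange_node {j : ℕ} (hnd : (labels (node v l r)).Nodup) (hv : v < j)
    (hroot : rootLabel l ≠ j) (hj : j ∉ labels r) :
    exchange j (node v l r) = node v (exchange j l) (r.map (Equiv.swap j (j + 1))) := by
  have hroot' : ¬(root? l = some j ∧ root? r = some (j + 1)) := fun h =>
    hroot (root?_eq_some_iff.1 h.1)
  have hr : ¬AreSiblings j (j + 1) r := fun h => hj h.mem.1
  have siblings_iff : AreSiblings j (j + 1) (node v l r) ↔ AreSiblings j (j + 1) l := by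
    simp only [AreSiblings, hroot', hr, false_or, or_false]
  simp only [exchange, siblings_iff]
  split_ifs with hl
  · have hj' : j + 1 ∉ labels r := List.disjoint_of_nodup_append hnd.of_cons hl.mem.2
    rw [siblingMove, Nat.add_sub_cancel, if_neg hroot', siblingMove_of_not_areSiblings hr,
      map_swap_eq_self hj hj']
  · rw [BinaryTree.map, swap_succ_of_lt hv]

theorem map_swap_eq_self_of_lt_rootLabel {j : ℕ} (ht : IsIncreasing t)
    (hj : (j + 1 : ℕ) < rootLabel t) : t.map (Equiv.swap j (j + 1)) = t :=
  have hlt := (lt_rootLabel_iff ht).1 hj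
  map_swap_eq_self (fun hm => (hlt j hm).not_gt j.lt_succ_self) fun hm => (hlt _ hm).false

theorem exchange_of_lt_rootLabel {j : ℕ} (hyj : y < j) (ht : IsIncreasing t)
    (hj : (j + 1 : ℕ) < rootLabel t) :
    exchange j (node y (leaf j) t) = node y (leaf (j + 1)) t := by
  have hnot : ¬AreSiblings j (j + 1) (node y (leaf j) t) := by
    rintro (⟨-, h⟩ | h | h)
    · exact hj.ne' (root?_eq_some_iff.1 h)
    · simp [leaf, AreSiblings, root?] at h
    · exact ((lt_rootLabel_iff ht).1 hj _ h.mem.2).false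
  rw [exchange, if_neg hnot, BinaryTree.map, map_swap_eq_self_of_lt_rootLabel ht hj,
    swap_succ_of_lt hyj]
  simp only [leaf, BinaryTree.map, Equiv.swap_apply_left]

theorem exchange_siblings (y j : ℕ) (l r : BinaryTree ℕ) :
    exchange j (node y (leaf j) (node (j + 1) l r)) = node y (node j (leaf (j + 1)) r) l := by
  have hsib : AreSiblings j (j + 1) (node y (leaf j) (node (j + 1) l r)) := .inl ⟨rfl, rfl⟩
  rw [exchange, if_pos hsib]
  simp [siblingMove, leaf, root?, BinaryTree.left, BinaryTree.right]

theorem exchange_graft_of_lt_rootLabel {j : ℕ} (h : Graftable j y t)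
    (hj : (j + 1 : ℕ) < rootLabel t) :
    exchange j (graft j y t) = graft (j + 1) y (t.map (Equiv.swap j (j + 1))) := by
  have hjt : (j : ℕ∞) < rootLabel t := (Nat.cast_lt.2 j.lt_succ_self).trans hj
  rw [map_swap_eq_self_of_lt_rootLabel h.isIncreasing hj, graft_of_lt_rootLabel h.lt hjt,
    graft_of_lt_rootLabel (h.lt.trans j.lt_succ_self) hj,
    exchange_of_lt_rootLabel h.lt h.isIncreasing hj]

/-- The only comparison affected by exchanging `j` and `j + 1`: grafting `j` makes `j + 1` the right
sibling of the leaf `j`, whereas grafting `j + 1` pushes `j` into the right subtree of `j`. -/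
theorem exchange_graft_node_succ {j : ℕ} (h : Graftable j y (node (j + 1) l r)) :
    exchange j (graft j y (node (j + 1) l r)) =
      graft (j + 1) y ((node (j + 1) l r).map (Equiv.swap j (j + 1))) := by
  obtain ⟨hjl, -, hl, hr⟩ := isIncreasing_node.1 h.isIncreasing
  have hjr : (j + 1 : ℕ) < rootLabel r := (lt_rootLabel_iff hr).2 h.isIncreasing.2.1
  rw [graft_of_lt_rootLabel h.lt (Nat.cast_lt.2 j.lt_succ_self), exchange_siblings,
    BinaryTree.map, map_swap_eq_self_of_lt_rootLabel hl hjl,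
    map_swap_eq_self_of_lt_rootLabel hr hjr, Equiv.swap_apply_right, graft,
    if_neg h.lt.not_gt, if_pos j.lt_succ_self, graft_of_lt_rootLabel j.lt_succ_self hjr]

theorem exchange_graft {j : ℕ} (h : Graftable j y t) :
    exchange j (graft j y t) = graft (j + 1) y (t.map (Equiv.swap j (j + 1))) := by
  induction t generalizing y with
  | nil => exact exchange_graft_of_lt_rootLabel h (ENat.natCast_lt_top _)
  | node v l r ihl ihr =>
    have hnd : (labels (graft j y (node v l r))).Nodup := (labels_graft j y _).nodup_iff.2 h.nodup
    have hj : j ∉ labels (node v l r) := fun hm => h.nodup.notMem (List.mem_cons_of_mem y hm)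
    simp only [labels, List.mem_cons, List.mem_append, not_or] at hj
    have graft_root_ne (s : BinaryTree ℕ) {w : ℕ} (hw : w < j) : rootLabel (graft j w s) ≠ j := by
      rw [rootLabel_graft]
      exact ((min_le_left _ _).trans_lt (Nat.cast_lt.2 hw)).ne
    obtain hvj | rfl | hjv : v < j ∨ v = j + 1 ∨ j + 1 < v := by omega
    · rw [BinaryTree.map, swap_succ_of_lt hvj]
      rcases lt_or_gt_of_ne h.ne_root.2 with hvy | hyv
      · rw [graft, if_pos hvy] at hnd ⊢
        rw [exchange_node hnd hvj (graft_root_ne l h.lt) hj.2.2, ihl h.left, graft, if_pos hvy]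
      · rw [graft, if_neg hyv.not_gt, if_pos hvj] at hnd ⊢
        rw [exchange_node hnd h.lt (graft_root_ne r hvj) hj.2.1, ihr (h.right hvj), graft,
          if_neg hyv.not_gt, if_pos (hvj.trans j.lt_succ_self)]
    · exact exchange_graft_node_succ h
    · exact exchange_graft_of_lt_rootLabel h (Nat.cast_lt.2 hjv)

theorem strictMonoOn_swap_succ (j : ℕ) :
    StrictMonoOn (Equiv.swap j (j + 1)) {a | a ≠ j + 1} := by
  rintro a - b hb hab
  have hb' : b ≠ j + 1 := hb
  simp only [Equiv.swap_apply_def]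
  split_ifs <;> omega

theorem relabelDown_mem_DU {n : ℕ} {τ : List ℕ} (hσ : (y + 1) :: y :: τ ∈ DU n) :
    τ.map (relabelDown (y + 1)) ∈ DU (n - 2) := by
  obtain ⟨hdu, rfl, hbound⟩ := mem_DU_iff.1 hσ
  have hmem {a : ℕ} (ha : a ∈ τ) : a ≠ y ∧ a ≠ y + 1 := by
    have := hdu.1
    grind
  refine mem_DU_iff.2 ⟨map_mem_downUpWords ((strictMonoOn_relabelDown y).mono fun _ => hmem)
    (tail_tail_mem_downUpWords hdu), by simp, ?_⟩
  simp only [List.forall_mem_map]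
  intro a ha
  have hne := hmem ha
  simp only [List.forall_mem_cons, List.length_cons] at hbound ⊢
  have := hbound.2.2 a ha
  simp only [relabelDown]
  split_ifs <;> omega

theorem map_swap_mem_downUpWords {j : ℕ} {τ : List ℕ} (hσ : (j + 1) :: y :: τ ∈ downUpWords)
    (hyj : y < j) : ((j + 1) :: y :: τ).map (Equiv.swap j (j + 1)) ∈ downUpWords := by
  refine ⟨hσ.1.map (Equiv.injective _), ?_⟩
  obtain ⟨-, hhead, hτ⟩ := isDownUp_cons_cons.1 hσ.2
  have hmem : ∀ a ∈ τ, a ≠ j + 1 := fun a ha => by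
    rintro rfl
    exact hσ.1.notMem (List.mem_cons_of_mem y ha)
  simp only [List.map_cons, Equiv.swap_apply_right, swap_succ_of_lt hyj]
  refine isDownUp_cons_cons.2
    ⟨hyj, ?_, (isDownUp_map_iff ((strictMonoOn_swap_succ j).mono hmem)).2 hτ⟩
  intro b hb
  rw [List.head?_map] at hb
  obtain ⟨z, hz, rfl⟩ := Option.mem_map.1 hb
  rw [← swap_succ_of_lt hyj]
  exact strictMonoOn_swap_succ j (hyj.trans j.lt_succ_self).ne
    (hmem z (List.mem_of_mem_head? hz)) (hhead z hz)

theorem map_swap_mem_DU {n j : ℕ} {τ : List ℕ} (hσ : (j + 1) :: y :: τ ∈ DU n) (hyj : y < j) :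
    ((j + 1) :: y :: τ).map (Equiv.swap j (j + 1)) ∈ DU n := by
  obtain ⟨hdu, hlen, hbound⟩ := mem_DU_iff.1 hσ
  refine mem_DU_iff.2 ⟨map_swap_mem_downUpWords hdu hyj, by rwa [List.length_map], ?_⟩
  have hj := hbound (j + 1) (by simp)
  rw [List.forall_mem_map]
  intro a ha
  have := hbound a ha
  rw [Equiv.swap_apply_def]
  split_ifs <;> omega

theorem insertB_wordTree {τ : List ℕ} (hσ : (y + 1) :: y :: τ ∈ downUpWords) (hτ : τ ≠ []) :
    insertB (y + 1) ((wordTree (τ.map (relabelDown (y + 1)))).map (relabelUp (y + 1))) =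
      wordTree ((y + 1) :: y :: τ) := by
  have hne_nil : wordTree τ ≠ nil := by
    obtain ⟨z, τ, rfl⟩ := List.exists_cons_of_ne_nil hτ
    exact wordTree_cons_ne_nil z τ
  have hne : ∀ a ∈ τ, a ≠ y ∧ a ≠ y + 1 := fun a ha => by
    have := hσ.1
    grind
  have htree : (wordTree (τ.map (relabelDown (y + 1)))).map (relabelUp (y + 1)) = wordTree τ := by
    rw [wordTree_map ((strictMonoOn_relabelDown y).mono hne), ← BinaryTree.comp_map]
    refine map_eq_self fun a ha => ?_
    obtain ⟨ha, ha'⟩ := hne a ((labels_wordTree τ).mem_iff.1 ha)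
    exact relabelUp_relabelDown ha ha'
  rw [htree, wordTree, insertB_eq_graft (graftable_wordTree hσ) hne_nil]

theorem exchange_wordTree {j : ℕ} {τ : List ℕ} (hσ : (j + 1) :: y :: τ ∈ downUpWords)
    (hyj : y < j) :
    exchange j (wordTree (((j + 1) :: y :: τ).map (Equiv.swap j (j + 1)))) =
      wordTree ((j + 1) :: y :: τ) := by
  have hσ_swap := map_swap_mem_downUpWords hσ hyj
  have hmono : StrictMonoOn (Equiv.swap j (j + 1)) {a | a ∈ τ} :=
    (strictMonoOn_swap_succ j).mono fun a ha => by
      rintro rfl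
      exact hσ.1.notMem (List.mem_cons_of_mem y ha)
  simp only [List.map_cons, Equiv.swap_apply_right, swap_succ_of_lt hyj] at hσ_swap ⊢
  rw [wordTree, exchange_graft (graftable_wordTree hσ_swap), wordTree_map hmono,
    ← BinaryTree.comp_map, ← Equiv.Perm.coe_mul, Equiv.swap_mul_self,
    Equiv.Perm.coe_one, BinaryTree.id_map, wordTree]

theorem psi_cons_of_lt {j z : ℕ} (hyj : y < j) (τ : List ℕ) :
    psi ((j + 1) :: y :: z :: τ) =
      exchange j (psi (((j + 1) :: y :: z :: τ).map (Equiv.swap j (j + 1)))) := by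
  rw [psi, if_neg (by omega), dif_pos (by omega)]
  rfl

theorem psi_eq_wordTree {n : ℕ} {σ : List ℕ} (hσ : σ ∈ DU n) : psi σ = wordTree σ := by
  induction σ using psi.induct generalizing n with
  | case1 => rw [psi, wordTree]
  | case2 x =>
    obtain ⟨-, rfl, hbound⟩ := mem_DU_iff.1 hσ
    obtain ⟨hx, hx'⟩ := hbound x (List.mem_singleton_self x)
    obtain rfl : x = 1 := le_antisymm hx' hx
    rw [psi, wordTree]
  | case3 x y =>
    obtain ⟨hdu, rfl, hbound⟩ := mem_DU_iff.1 hσ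
    obtain ⟨rfl, rfl⟩ : x = 2 ∧ y = 1 := by
      have hyx := (isDownUp_cons_cons.1 hdu.2).1
      simp only [List.forall_mem_cons, List.length_cons, List.length_nil] at hbound
      omega
    rw [psi, wordTree, wordTree, graft]
  | case4 y z τ ih =>
    rw [psi, if_pos rfl, ih (relabelDown_mem_DU hσ),
      insertB_wordTree (mem_DU_iff.1 hσ).1 (List.cons_ne_nil z τ)]
  | case5 | case6 =>
    rename_i k y z τ _ hlt _ _ ih
    obtain ⟨j, rfl⟩ : ∃ j, k = j + 1 := ⟨k - 1, by omega⟩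
    have hyj : y < j := Nat.lt_of_succ_lt_succ hlt
    rw [psi_cons_of_lt hyj, ← exchange_wordTree (mem_DU_iff.1 hσ).1 hyj]
    exact congrArg (exchange j) (ih (map_swap_mem_DU hσ hyj))
  | case7 k y z τ hk hlt =>
    have := (isDownUp_cons_cons.1 (mem_DU_iff.1 hσ).1.2).1
    omega

end Entringer

theorem mainTheorem6 (n k : ℕ) :
    Set.BijOn Entringer.psi (Entringer.DUFirst n k) (Entringer.TreesLeaf n k) ∧
    Set.BijOn Entringer.psi' (Entringer.DUFirst n k) (Entringer.TreesLeaf n k) ∧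
    ∀ σ ∈ Entringer.DUFirst n k, Entringer.psi σ = Entringer.psi' σ := by
  have hpsi : ∀ σ ∈ Entringer.DUFirst n k, Entringer.psi σ = Entringer.wordTree σ :=
    fun σ hσ => Entringer.psi_eq_wordTree hσ.1
  have hpsi' : ∀ σ ∈ Entringer.DUFirst n k, Entringer.psi' σ = Entringer.wordTree σ :=
    fun σ hσ => Entringer.psi'_eq_wordTree (Entringer.mem_DU_iff.1 hσ.1).1
  have hbij := Entringer.bijOn_wordTree_DUFirst n k
  exact ⟨hbij.congr fun σ hσ => (hpsi σ hσ).symm, hbij.congr fun σ hσ => (hpsi' σ hσ).symm,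
    fun σ hσ => (hpsi σ hσ).trans (hpsi' σ hσ).symm⟩
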